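/- **Setup.** Let $k$ be an algebraically closed field, $d\ge 1$, and $j^*=2d+1-j$ for $1\le j\le 2d$. Let $I(d,2d)$ be the set of $d$-element subsets of $\{1,\dots,2d\}$, ordered by termwise comparison of the increasingly listed elements, and let $I(d)\subset I(d,2d)$ consist of those subsets which contain exactly one of $j,j^*$ for every $j$. Fix $\alpha\le\beta\le\gamma$ in $I(d)$. *Roots and chains.* A root is a pair $(r,c)$ with $r\in\{1,\dots,2d\}\setminus\beta$ and $c\in\beta$. It is upper if $r\le c^*$, diagonal if $r=c^*$, positive if $r>c$ and negative if $r<c$. Put $(r,c)^\#=(c^*,r^*)$. A chain is a finite (possibly empty) set $C$ of roots such that of any two distinct elements $(R,C'),(r,c)$ of it, in a suitable order, $R>r$ and $C'<c$. Let $C^+$ and $C^-$ be the sets of its positive and negative elements. For a multiset $X$ of roots let $X_{(1)},X_{(2)}$ be the multisets of its first and second coordinates. For a chain $C$ put $C_{(1)}-C_{(2)}=(\beta\setminus C_{(2)})\cup C_{(1)}\in I(d,2d)$. For multisets of roots $X,Y$ write $X\le Y$ if $X_{(1)}\cup Y_{(2)}\le Y_{(1)}\cup X_{(2)}$ termwise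 (unions with multiplicity; in particular the two sides have the same number of elements). *The polynomials.* Let $P=k[X_{(r,c)} : (r,c)\text{ an upper root}]$. For a root $(r,c)$ with $r>c^*$ put $X_{(r,c)}=-X_{(c^*,r^*)}$ if exactly one of $r,c^*$ is greater than $d$, and $X_{(r,c)}=X_{(c^*,r^*)}$ otherwise. For $\theta\in I(d,2d)$ let $f_{\theta,\beta}=\det\bigl(X_{(r,c)}\bigr)_{r\in\theta\setminus\beta,\ c\in\beta\setminus\theta}$, with rows and columns in increasing order. An admissible pair is $\mathfrak w=(x,y)$ with $x,y\in I(d)$, $x\ge y$ and $|x\setminus\{1,\dots,d\}|=|y\setminus\{1,\dots,d\}|$; put $f_{\mathfrak w,\beta}=f_{\theta,\beta}$ with $\theta=(x\cap\{1,\dots,d\})\cup(y\setminus\{1,\dots,d\})$. Order the variables by $X_{(r,c)}>X_{(r',c')}$ if $r>r'$, or $r=r'$ and $c<c'$; initial terms are taken with respect to the homogeneous lexicographic order. A polynomial's initial term forms the chain $C$ if its monomial is $\prod_{(r,c)\in C}X_{(r,c)}$. An admissible pair $\mathfrak w=(t,u)$ is good if 1. $\alpha\not\le u$ or $t\not\le\gamma$;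 and 2. the initial term of $f_{\mathfrak w,\beta}$ forms a chain $C$ of positive upper roots with $C_{(1)}-C_{(2)}\not\le\gamma$, or a chain $C$ of negative upper roots with $C_{(1)}-C_{(2)}\not\ge\alpha$. Let $G_{\alpha,\beta}^\gamma(\mathrm{good})=\{f_{\mathfrak w,\beta} : \mathfrak w\text{ good}\}$, and let $\operatorname{in}G_{\alpha,\beta}^\gamma(\mathrm{good})\subset P$ be the ideal generated by the initial terms of its elements. *Multisets.* Let $T_\alpha,W_\gamma$ be any sets of roots with $(T_\alpha)_{(1)}=\alpha\setminus\beta$, $(T_\alpha)_{(2)}=\beta\setminus\alpha$, $(W_\gamma)_{(1)}=\gamma\setminus\beta$, $(W_\gamma)_{(2)}=\beta\setminus\gamma$ (as multisets). A finite multiset $\mathfrak S$ of roots is bounded by $T_\alpha,W_\gamma$ if $T_\alpha\le D^-$ and $D^+\le W_\gamma$ for every chain $D$ whose elements belong to $\mathfrak S$. It is special if $\mathfrak S=\mathfrak S^\#$ and every diagonal root has even multiplicity in $\mathfrak S$. It is non-vanishing if $r\ne c$ for all $(r,c)\in\mathfrak S$. Its degree is its number of elements, counted with multiplicity. **Theorem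 4.1.** Identify a monomial of $P$ with the multiset $U$ of upper roots that index its variables. Then $U\mapsto U\cup U^\#$ (union with multiplicities) maps the set of all monomials of $P$ that do not lie in $\operatorname{in}G_{\alpha,\beta}^\gamma(\mathrm{good})$ into the set of all non-vanishing special multisets of roots bounded by $T_\alpha,W_\gamma$. This map is injective, and $\deg(U\cup U^\#)=2\deg U$. -/

import Mathlib

noncomputable section

namespace SympGrass

/-!
Throughout, the index set `{1, …, 2d}` is `Fin (2 * d)` (the number `i` is the element `i - 1`),
so that `i* = 2d + 1 - i` is `Fin.rev i`, and `i ≤ d` reads `i.val < d`.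
-/

/-- Termwise comparison of two finite multisets: after sorting both increasingly, they have the
same number of elements and each element of the first is at most the corresponding element of
the second. -/
def TermLE {n : ℕ} (A B : Multiset (Fin n)) : Prop :=
  List.Forall₂ (· ≤ ·) (A.sort (· ≤ ·)) (B.sort (· ≤ ·))

/-- `I(d, 2d)`: the `d`-element subsets of `{1, …, 2d}`. -/
structure Idx (d : ℕ) where
  carrier : Finset (Fin (2 * d))
  card_carrier : carrier.card = d

/-- The order on `I(d, 2d)`: `θ ≤ φ` if `θ(i) ≤ φ(i)` for all `i`. -/
instance {d : ℕ} : LE (Idx d) := ⟨fun θ φ => TermLE θ.carrier.val φ.carrier.val⟩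

/-- Membership in `I(d)`: exactly one of `i`, `i*` belongs to `θ`, for every `i`. -/
def Idx.IsIsotropic {d : ℕ} (θ : Idx d) : Prop :=
  ∀ i : Fin (2 * d), i ∈ θ.carrier ↔ i.rev ∉ θ.carrier

/-- `ε = {1, …, d}`. -/
def eps (d : ℕ) : Finset (Fin (2 * d)) := Finset.univ.filter fun i => i.val < d

/-- An admissible pair `(x, y)`: `x ≥ y` in `I(d)`, with equal `ε`-degrees. -/
structure AdmissiblePair (d : ℕ) where
  top : Idx d
  bot : Idx d
  top_isotropic : top.IsIsotropic
  bot_isotropic : bot.IsIsotropic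
  bot_le_top : bot ≤ top
  epsDegree_eq : (top.carrier \ eps d).card = (bot.carrier \ eps d).card

/-- The element `θ = (x ∩ {1, …, d}) ∪ (y ∖ {1, …, d})` of `I(d, 2d)` attached to `(x, y)`. -/
def AdmissiblePair.theta {d : ℕ} (w : AdmissiblePair d) : Idx d where
  carrier := (w.top.carrier ∩ eps d) ∪ (w.bot.carrier \ eps d)
  card_carrier := by
    have hdisj : Disjoint (w.top.carrier ∩ eps d) (w.bot.carrier \ eps d) := by
      rw [Finset.disjoint_left]
      intro a ha hb
      exact (Finset.mem_sdiff.1 hb).2 (Finset.mem_inter.1 ha).2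
    rw [Finset.card_union_of_disjoint hdisj, ← w.epsDegree_eq,
      Finset.card_inter_add_card_sdiff, w.top.card_carrier]

/-- The involution `(r, c) ↦ (c*, r*)`. -/
def hash {n : ℕ} (p : Fin n × Fin n) : Fin n × Fin n := (p.2.rev, p.1.rev)

/-- The pairs `(r, c)` with `r ∉ β`, `c ∈ β`. -/
def IsRoot {n : ℕ} (β : Finset (Fin n)) (p : Fin n × Fin n) : Prop := p.1 ∉ β ∧ p.2 ∈ β

/-- The roots on or above the diagonal: `r ≤ c*`. -/
def IsUpperRoot {n : ℕ} (β : Finset (Fin n)) (p : Fin n × Fin n) : Prop :=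
  IsRoot β p ∧ p.1 ≤ p.2.rev

/-- The index set of the variables of the polynomial ring `P`. -/
structure UpperRoot {n : ℕ} (β : Finset (Fin n)) where
  pair : Fin n × Fin n
  isUpperRoot : IsUpperRoot β pair

theorem UpperRoot.pair_injective {n : ℕ} {β : Finset (Fin n)} :
    Function.Injective (UpperRoot.pair (β := β)) := by
  rintro ⟨p, hp⟩ ⟨q, hq⟩ h
  cases h
  rfl

/-- Sorting key of a variable: larger `r` first, and for equal `r` smaller `c` first. -/
def UpperRoot.key {n : ℕ} {β : Finset (Fin n)} (p : UpperRoot β) : Fin n ×ₗ Fin n :=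
  toLex (p.pair.1.rev, p.pair.2)

theorem UpperRoot.key_injective {n : ℕ} {β : Finset (Fin n)} :
    Function.Injective (UpperRoot.key (β := β)) := by
  intro p q h
  have h' : (p.pair.1.rev, p.pair.2) = (q.pair.1.rev, q.pair.2) := h
  rw [Prod.mk.injEq, Fin.rev_inj] at h'
  exact UpperRoot.pair_injective (Prod.ext h'.1 h'.2)

/-- The variables are listed so that an earlier index is a more significant variable (this is
the convention of Mathlib's monomial orders): `X_(r,c)` is more significant than `X_(r',c')` if
`r > r'`, or `r = r'` and `c < c'`. -/
instance {n : ℕ} {β : Finset (Fin n)} : LinearOrder (UpperRoot β) :=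
  LinearOrder.lift' UpperRoot.key UpperRoot.key_injective

instance {n : ℕ} {β : Finset (Fin n)} : Finite (UpperRoot β) :=
  Finite.of_injective _ UpperRoot.pair_injective

/-- The homogeneous lexicographic term order. -/
def termOrder {n : ℕ} (β : Finset (Fin n)) : MonomialOrder (UpperRoot β) :=
  MonomialOrder.degLex

/-- The polynomial ring `P = k[X_(r,c) : (r,c) an upper root]`. -/
abbrev CoordRing (k : Type*) [Field k] {n : ℕ} (β : Finset (Fin n)) : Type _ :=
  MvPolynomial (UpperRoot β) k

/-- The `(r, c)` entry of the `2d × d` coordinate matrix. The rows in `β` form the identity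
matrix; an entry with `r ∉ β` is the variable `X_(r,c)`, where `X_(r,c) = - X_(c*,r*)` if exactly
one of `r`, `c*` exceeds `d`, and `X_(r,c) = X_(c*,r*)` otherwise. (The last branch is not
reached when `c ∈ β ∈ I(d)`.) -/
def entry (k : Type*) [Field k] {d : ℕ} (β : Finset (Fin (2 * d))) (r c : Fin (2 * d)) :
    CoordRing k β :=
  open Classical in
  if r ∈ β then (if r = c then 1 else 0)
  else if h : IsUpperRoot β (r, c) then MvPolynomial.X ⟨(r, c), h⟩
  else if h : IsUpperRoot β (hash (r, c)) then
    (if (r.val < d ↔ c.rev.val < d) then MvPolynomial.X ⟨hash (r, c), h⟩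
      else - MvPolynomial.X ⟨hash (r, c), h⟩)
  else 0

theorem card_sdiff_eq {d : ℕ} (β θ : Idx d) :
    (β.carrier \ θ.carrier).card = (θ.carrier \ β.carrier).card :=
  Finset.card_sdiff_comm (β.card_carrier.trans θ.card_carrier.symm)

/-- `f_{θ,β}`: the minor with rows `θ ∖ β` and columns `β ∖ θ` (both in increasing order). -/
def minor (k : Type*) [Field k] {d : ℕ} (β θ : Idx d) : CoordRing k β.carrier :=
  Matrix.det (Matrix.of fun i j : Fin (θ.carrier \ β.carrier).card =>
    entry k β.carrier ((θ.carrier \ β.carrier).orderEmbOfFin rfl i)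
      ((β.carrier \ θ.carrier).orderEmbOfFin (card_sdiff_eq β θ) j))

/-- `f_{𝔴,β}` for an admissible pair `𝔴`. -/
def pairMinor (k : Type*) [Field k] {d : ℕ} (β : Idx d) (w : AdmissiblePair d) :
    CoordRing k β.carrier :=
  minor k β w.theta

/-- An extended chain: any two distinct elements `(R, C)`, `(r, c)` satisfy `R > r` and `C < c`,
or the other way round. -/
def IsExtChain {n : ℕ} (C : Finset (Fin n × Fin n)) : Prop :=
  IsChain (fun p q : Fin n × Fin n => p.1 > q.1 ∧ p.2 < q.2) (C : Set (Fin n × Fin n))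

/-- The positive part: `r > c`. -/
def posPart {n : ℕ} (C : Finset (Fin n × Fin n)) : Finset (Fin n × Fin n) :=
  C.filter fun p => p.1 > p.2

/-- The negative part (on a set of roots, where `r ≠ c`, this is the complement of the
positive part). -/
def negPart {n : ℕ} (C : Finset (Fin n × Fin n)) : Finset (Fin n × Fin n) :=
  C.filter fun p => p.1 < p.2

/-- `C₍₁₎ - C₍₂₎ = (β ∖ C₍₂₎) ∪ C₍₁₎`, where `C₍₁₎` and `C₍₂₎` are the first and the second
coordinates of the elements of the chain `C`. -/
def chainWeight {n : ℕ} (β : Finset (Fin n)) (C : Finset (Fin n × Fin n)) : Finset (Fin n) :=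
  (β \ C.image Prod.snd) ∪ C.image Prod.fst

/-- The leading monomial of `f` is the squarefree product of the variables in the chain `C`. -/
def InitFormsChain {k : Type*} [Field k] {n : ℕ} {β : Finset (Fin n)} (f : CoordRing k β)
    (C : Finset (Fin n × Fin n)) : Prop :=
  IsExtChain C ∧ (Finsupp.toMultiset ((termOrder β).degree f)).map UpperRoot.pair = C.val

/-- Good admissible pairs. -/
def IsGood (k : Type*) [Field k] {d : ℕ} (α β γ : Idx d) (w : AdmissiblePair d) : Prop :=
  (¬ α ≤ w.bot ∨ ¬ w.top ≤ γ) ∧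
  ((∃ C : Finset (Fin (2 * d) × Fin (2 * d)), InitFormsChain (pairMinor k β w) C ∧
      posPart C = C ∧ ¬ TermLE (chainWeight β.carrier C).val γ.carrier.val) ∨
   (∃ C : Finset (Fin (2 * d) × Fin (2 * d)), InitFormsChain (pairMinor k β w) C ∧
      negPart C = C ∧ ¬ TermLE α.carrier.val (chainWeight β.carrier C).val))

/-- The set `G_{α,β}^γ(good)`. -/
def goodSet (k : Type*) [Field k] {d : ℕ} (α β γ : Idx d) : Set (CoordRing k β.carrier) :=
  {f | ∃ w : AdmissiblePair d, IsGood k α β γ w ∧ f = pairMinor k β w}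

/-- `in S`: the ideal generated by the initial terms of the elements of `S`. -/
def initialIdeal {k : Type*} [Field k] {n : ℕ} {β : Finset (Fin n)} (S : Set (CoordRing k β)) :
    Ideal (CoordRing k β) :=
  Ideal.span ((termOrder β).leadingTerm '' S)

/-- The (exponents of the) monomials of `P` that do not lie in `in G_{α,β}^γ(good)`. -/
def outsideMonomials (k : Type*) [Field k] {d : ℕ} (α β γ : Idx d) :
    Set (UpperRoot β.carrier →₀ ℕ) :=
  {U | MvPolynomial.monomial U (1 : k) ∉ initialIdeal (goodSet k α β γ)}

/-- `X ≤ Y` for multisets `X`, `Y` of pairs, i.e. `X₍₁₎ - X₍₂₎ ≤ Y₍₁₎ - Y₍₂₎`; by definition this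
means that `X₍₁₎ ∪ Y₍₂₎ ≤ Y₍₁₎ ∪ X₍₂₎` termwise (unions of multisets). -/
def PairsLE {n : ℕ} (X Y : Multiset (Fin n × Fin n)) : Prop :=
  TermLE (X.map Prod.fst + Y.map Prod.snd) (Y.map Prod.fst + X.map Prod.snd)

/-- The multiset `S` is bounded by `T`, `W`: every chain `D` in `S` satisfies
`T ≤ D⁻` and `D⁺ ≤ W`. -/
def IsBoundedBy {n : ℕ} (T W : Finset (Fin n × Fin n)) (S : Multiset (Fin n × Fin n)) : Prop :=
  ∀ D : Finset (Fin n × Fin n), (∀ p ∈ D, p ∈ S) → IsExtChain D →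
    PairsLE T.val (negPart D).val ∧ PairsLE (posPart D).val W.val

/-- A multiset of pairs is nonvanishing if `r ≠ c` for each of its elements `(r, c)`. -/
def IsNonvanishing {n : ℕ} (S : Multiset (Fin n × Fin n)) : Prop := ∀ p ∈ S, p.1 ≠ p.2

/-- Special multisets: `S = S^#`, and diagonal elements have even multiplicity. -/
def IsSpecial {n : ℕ} (S : Multiset (Fin n × Fin n)) : Prop :=
  S.map hash = S ∧ ∀ p : Fin n × Fin n, p.1 = p.2.rev → Even (S.count p)

/-- The nonvanishing special multisets on the roots of `β` bounded by `T`, `W`. -/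
def boundedSpecialMultisets {n : ℕ} (β : Finset (Fin n)) (T W : Finset (Fin n × Fin n)) :
    Set (Multiset (Fin n × Fin n)) :=
  {S | (∀ p ∈ S, IsRoot β p) ∧ IsNonvanishing S ∧ IsSpecial S ∧ IsBoundedBy T W S}

/-- `T` is a set of roots of `β` with `T₍₁₎ = θ ∖ β` and `T₍₂₎ = β ∖ θ` (as multisets). -/
def Represents {n : ℕ} (β θ : Finset (Fin n)) (T : Finset (Fin n × Fin n)) : Prop :=
  (∀ p ∈ T, IsRoot β p) ∧ T.val.map Prod.fst = (θ \ β).val ∧ T.val.map Prod.snd = (β \ θ).val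

/-- The map `U ↦ U ∪ U^#` (union with multiplicities). -/
def doubling {n : ℕ} {β : Finset (Fin n)} (U : UpperRoot β →₀ ℕ) : Multiset (Fin n × Fin n) :=
  (Finsupp.toMultiset U).map UpperRoot.pair +
    ((Finsupp.toMultiset U).map UpperRoot.pair).map hash

end SympGrass

end

/-! Injectivity, degree and the special property are formal; boundedness is the substance, and it is
proved by contraposition. Suppose a chain `D` in `U ∪ U^#` violates one of the bounds. Termwise
comparison is domination of the functions counting elements below a threshold (`termLE_iff`), so the
violation occurs at one threshold `x`, and only the subchain `E` of roots straddling `x` contributes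
to it (`exists_of_not_pairsLE_neg`, `exists_of_not_pairsLE_pos`).

Replace each member of `E` below the diagonal by its image under `#`. The result is a chain of
distinct upper roots, all indexing variables of `U` (`exists_folding`). It straddles `min x (2d - x)
≤ d`, and by isotropy the violation persists there.

The minor on the rows and columns of such a chain has the product of its variables as leading
monomial: expand the determinant and note that the diagonal term is strictly largest
(`degree_det_monomial`, `degree_minor`). It remains to realise a suitable minor by a good admissible
pair. An index `θ` comes from an admissible pair as soon as one inequality between its counts at `z`
and `2d - z` holds (`exists_admissiblePair`). For a positive chain its own weight satisfies this.
For a negative chain the reflected minor is used, which has the same leading monomial by the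
symmetry of the coordinate matrix (`degree_minor_hash`). The violation at the threshold makes the
pair good, and the leading monomial divides `U`, so `U` lies in the initial ideal. -/

noncomputable section

namespace SympGrass

open Finset

/-! ### Leading monomials of determinants with monomial entries -/

/-- If the diagonal variables `v i` increase and every off-diagonal variable `w i j` comes strictly
after `v (min i j)`, then a nontrivial permutation gives a smaller monomial than the diagonal. -/
theorem perm_monomial_lt {σ : Type*} [LinearOrder σ] [WellFoundedGT σ] {m : ℕ} {v : Fin m → σ}
    (hv : StrictMono v) {w : Fin m → Fin m → σ} (hd : ∀ i, w i i = v i)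
    (hw : ∀ i j, i ≠ j → v (min i j) < w i j) {π : Equiv.Perm (Fin m)} (hπ : π ≠ 1) :
    (MonomialOrder.degLex (σ := σ)).toSyn (∑ j, Finsupp.single (w (π j) j) 1) <
      (MonomialOrder.degLex (σ := σ)).toSyn (∑ j, Finsupp.single (v j) 1) := by
  classical
  have hex : (univ.filter fun i => π i ≠ i).Nonempty := by
    by_contra h
    rw [Finset.not_nonempty_iff_eq_empty, Finset.filter_eq_empty_iff] at h
    exact hπ (Equiv.ext fun i => by simpa using h (mem_univ i))
  -- The first index moved by `π` decides: the exponents of all variables preceding `v i` agree,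
  -- while `v i` occurs once in the diagonal product and not at all in the permuted one.
  set i := (univ.filter fun i => π i ≠ i).min' hex with hi
  have hi1 : π i ≠ i := (Finset.mem_filter.1 (Finset.min'_mem _ hex)).2
  have hlt : ∀ j, j < i → π j = j := by
    intro j hj
    by_contra hne
    exact absurd (Finset.min'_le _ j (Finset.mem_filter.2 ⟨mem_univ j, hne⟩)) (not_le.2 hj)
  have hge : ∀ j, i ≤ j → i ≤ π j := by
    intro j hj
    by_contra! hne
    have := π.injective (hlt _ hne)
    omega
  have hgt : ∀ j, i ≤ j → (π j ≠ j ∨ i < j) → v i < w (π j) j := by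
    intro j hj h
    by_cases hpj : π j = j
    · rw [hpj, hd]
      exact hv (h.resolve_left (not_not.2 hpj))
    · exact (hv.monotone (le_min (hge j hj) hj)).trans_lt (hw _ _ hpj)
  rw [MonomialOrder.degLex_lt_iff, Finsupp.DegLex.lt_iff]
  -- Both monomials have total degree `m`, so the lexicographic comparison decides.
  refine Or.inr ⟨by simp, ?_⟩
  refine ⟨v i, ?_, ?_⟩
  · intro s hs
    change (∑ j, Finsupp.single (w (π j) j) 1) s = (∑ j, Finsupp.single (v j) 1) s
    rw [Finsupp.finsetSum_apply, Finsupp.finsetSum_apply]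
    refine Finset.sum_congr rfl fun j _ => ?_
    rcases lt_or_ge j i with hj | hj
    · rw [hlt j hj, hd]
    · have h1 : v i ≤ w (π j) j := by
        rcases hj.eq_or_lt with rfl | h
        · exact (hgt _ le_rfl (Or.inl hi1)).le
        · exact (hgt _ hj (Or.inr h)).le
      have h2 : v i ≤ v j := hv.monotone hj
      rw [Finsupp.single_eq_of_ne (hs.trans_le h1).ne, Finsupp.single_eq_of_ne (hs.trans_le h2).ne]
  · change (∑ j, Finsupp.single (w (π j) j) 1) (v i) < (∑ j, Finsupp.single (v j) 1) (v i)
    rw [Finsupp.finsetSum_apply, Finsupp.finsetSum_apply]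
    refine Finset.sum_lt_sum (fun j _ => ?_) ⟨i, mem_univ i, ?_⟩
    · rcases lt_or_ge j i with hj | hj
      · rw [hlt j hj, hd]
      · have h1 : v i < w (π j) j := by
          rcases hj.eq_or_lt with rfl | h
          · exact hgt _ le_rfl (Or.inl hi1)
          · exact hgt _ hj (Or.inr h)
        rw [Finsupp.single_eq_of_ne h1.ne]
        exact Nat.zero_le _
    · rw [Finsupp.single_eq_of_ne (hgt i le_rfl (Or.inl hi1)).ne, Finsupp.single_eq_same]
      exact Nat.one_pos

/-- Each permutation contributes a single monomial to the expansion. The identity gives the strictly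
largest one, so its coefficient, the product of the `a i i` and hence nonzero, cannot cancel. -/
theorem degree_det_monomial {k σ : Type*} [Field k] [LinearOrder σ] [WellFoundedGT σ] {m : ℕ}
    {v : Fin m → σ} (hv : StrictMono v) {w : Fin m → Fin m → σ} (hd : ∀ i, w i i = v i)
    (hw : ∀ i j, i ≠ j → v (min i j) < w i j) {a : Fin m → Fin m → k} (ha : ∀ i, a i i ≠ 0)
    {M : Matrix (Fin m) (Fin m) (MvPolynomial σ k)}
    (hM : ∀ i j, M i j = MvPolynomial.monomial (Finsupp.single (w i j) 1) (a i j)) :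
    M.det ≠ 0 ∧ (MonomialOrder.degLex (σ := σ)).degree M.det = ∑ j, Finsupp.single (v j) 1 := by
  classical
  set e : σ →₀ ℕ := ∑ j, Finsupp.single (v j) 1 with he
  have hdet : M.det = ∑ π : Equiv.Perm (Fin m), MvPolynomial.monomial
      (∑ j, Finsupp.single (w (π j) j) 1) (((Equiv.Perm.sign π : ℤ) : k) * ∏ j, a (π j) j) := by
    rw [Matrix.det_apply']
    refine Finset.sum_congr rfl fun π _ => ?_
    simp only [hM]
    rw [← MvPolynomial.monomial_sum_prod, ← MvPolynomial.C_mul_monomial]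
    simp
  have hcoeff : M.det.coeff e ≠ 0 := by
    rw [hdet, MvPolynomial.coeff_sum, Finset.sum_eq_single 1]
    · have : (∑ j, Finsupp.single (w ((1 : Equiv.Perm (Fin m)) j) j) 1) = e := by simp [hd, he]
      rw [this, MvPolynomial.coeff_monomial, if_pos rfl]
      simp [Finset.prod_ne_zero_iff, ha]
    · intro π _ hπ
      rw [MvPolynomial.coeff_monomial, if_neg]
      intro h
      exact (perm_monomial_lt hv hd hw hπ).ne (by rw [h])
    · simp
  refine ⟨fun h => hcoeff (by rw [h, MvPolynomial.coeff_zero]), ?_⟩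
  apply (MonomialOrder.degLex (σ := σ)).toSyn.injective
  apply le_antisymm
  · rw [MonomialOrder.degree_le_iff]
    intro c hc
    rw [hdet] at hc
    obtain ⟨π, _, hπ⟩ := Finset.mem_biUnion.1 (MvPolynomial.support_sum hc)
    have := Finset.mem_singleton.1 (MvPolynomial.support_monomial_subset hπ)
    subst this
    by_cases h : π = 1
    · subst h
      simp [hd, he]
    · exact (perm_monomial_lt hv hd hw h).le
  · exact MonomialOrder.le_degree (MvPolynomial.mem_support_iff.2 hcoeff)

/-! ### The entries of the coordinate matrix as signed variables -/

theorem hash_hash {n : ℕ} (p : Fin n × Fin n) : hash (hash p) = p := by simp [hash]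

theorem rev_mem_iff {d : ℕ} {β : Idx d} (hβ : β.IsIsotropic) (i : Fin (2 * d)) :
    i.rev ∈ β.carrier ↔ i ∉ β.carrier := by
  rw [hβ i, not_not]

theorem isRoot_hash {d : ℕ} {β : Idx d} (hβ : β.IsIsotropic) {p : Fin (2 * d) × Fin (2 * d)}
    (hp : IsRoot β.carrier p) : IsRoot β.carrier (hash p) :=
  ⟨(hβ _).1 hp.2, (rev_mem_iff hβ _).2 hp.1⟩

theorem upper_or_hash_upper {n : ℕ} (p : Fin n × Fin n) :
    p.1 ≤ p.2.rev ∨ (hash p).1 ≤ (hash p).2.rev := by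
  simpa [hash] using le_total p.1 p.2.rev

open Classical in
/-- The variable which occurs, up to sign, in the entry at a root. -/
def rootVar {d : ℕ} {β : Idx d} (hβ : β.IsIsotropic) (p : Fin (2 * d) × Fin (2 * d))
    (hp : IsRoot β.carrier p) : UpperRoot β.carrier :=
  if h : p.1 ≤ p.2.rev then ⟨p, hp, h⟩
  else ⟨hash p, isRoot_hash hβ hp, (upper_or_hash_upper p).resolve_left h⟩

theorem rootVar_pair {d : ℕ} {β : Idx d} (hβ : β.IsIsotropic) (p : Fin (2 * d) × Fin (2 * d))
    (hp : IsRoot β.carrier p) :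
    (rootVar hβ p hp).pair = if p.1 ≤ p.2.rev then p else hash p := by
  unfold rootVar
  split_ifs <;> rfl

theorem rootVar_hash {d : ℕ} {β : Idx d} (hβ : β.IsIsotropic) (p : Fin (2 * d) × Fin (2 * d))
    (hp : IsRoot β.carrier p) :
    rootVar hβ (hash p) (isRoot_hash hβ hp) = rootVar hβ p hp := by
  apply UpperRoot.pair_injective
  rw [rootVar_pair, rootVar_pair, hash_hash]
  obtain ⟨r, c⟩ := p
  simp only [hash, Fin.rev_rev]
  split_ifs with h1 h2 h2
  · have : r = c.rev := le_antisymm h2 h1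
    subst this
    simp
  · rfl
  · rfl
  · exact absurd (le_of_not_ge h1) h2

theorem entry_eq_monomial (k : Type*) [Field k] {d : ℕ} {β : Idx d} (hβ : β.IsIsotropic)
    (r c : Fin (2 * d)) (hp : IsRoot β.carrier (r, c)) :
    ∃ a : k, a ≠ 0 ∧ entry k β.carrier r c =
      MvPolynomial.monomial (Finsupp.single (rootVar hβ (r, c) hp) 1) a := by
  classical
  unfold entry rootVar
  rw [if_neg hp.1]
  by_cases h : r ≤ c.rev
  · rw [dif_pos ⟨hp, h⟩, dif_pos h]
    exact ⟨1, one_ne_zero, rfl⟩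
  · have h' : IsUpperRoot β.carrier (hash (r, c)) :=
      ⟨isRoot_hash hβ hp, (upper_or_hash_upper (r, c)).resolve_left h⟩
    rw [dif_neg (fun h1 => h h1.2), dif_neg h, dif_pos h']
    split_ifs
    · exact ⟨1, one_ne_zero, rfl⟩
    · refine ⟨-1, by simp, ?_⟩
      rw [map_neg]
      rfl

theorem upperRoot_lt_iff {n : ℕ} {β : Finset (Fin n)} (p q : UpperRoot β) :
    p < q ↔ q.pair.1 < p.pair.1 ∨ q.pair.1 = p.pair.1 ∧ p.pair.2 < q.pair.2 := by
  change p.key < q.key ↔ _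
  unfold UpperRoot.key
  rw [Prod.Lex.toLex_lt_toLex]
  simp [eq_comm]

/-! ### Leading monomials of the minors attached to chains of upper roots -/

section Chain

variable {d m : ℕ} {β : Idx d} {R C : Fin m → Fin (2 * d)}

theorem rootVar_diag_strictMono (hβ : β.IsIsotropic) (hR : StrictAnti R)
    (hp : ∀ i j, IsRoot β.carrier (R i, C j)) (hu : ∀ i, R i ≤ (C i).rev) :
    StrictMono fun i => rootVar hβ (R i, C i) (hp i i) := by
  intro i j hij
  rw [upperRoot_lt_iff, rootVar_pair, rootVar_pair, if_pos (hu i), if_pos (hu j)]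
  exact Or.inl (hR hij)

/-- An upper root in the row of the diagonal one has a larger column; otherwise its row index is
smaller. A root `(r, c)` below the diagonal folds to a root in row `c* < r`, which only moves the
variable further down the order. -/
theorem rootVar_diag_lt (hβ : β.IsIsotropic) (hR : StrictAnti R) (hC : StrictMono C)
    (hp : ∀ i j, IsRoot β.carrier (R i, C j)) (hu : ∀ i, R i ≤ (C i).rev) {i j : Fin m}
    (hij : i ≠ j) :
    rootVar hβ (R (min i j), C (min i j)) (hp _ _) < rootVar hβ (R i, C j) (hp i j) := by
  rw [upperRoot_lt_iff, rootVar_pair, rootVar_pair, if_pos (hu _)]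
  rcases lt_or_gt_of_ne hij with h | h
  · rw [min_eq_left h.le]
    split_ifs with h1
    · exact Or.inr ⟨rfl, hC h⟩
    · exact Or.inl (not_le.1 h1)
  · rw [min_eq_right h.le]
    split_ifs with h1
    · exact Or.inl (hR h)
    · exact Or.inl ((not_le.1 h1).trans (hR h))

/-- The chain lists its rows decreasingly, the minor increasingly; reversing the rows costs at most
a sign. -/
theorem minor_eq_det (k : Type*) [Field k] (θ : Idx d) (hR : StrictAnti R) (hC : StrictMono C)
    (h1 : θ.carrier \ β.carrier = univ.image R) (h2 : β.carrier \ θ.carrier = univ.image C) :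
    minor k β θ = (Matrix.of fun i j => entry k β.carrier (R i) (C j)).det ∨
      minor k β θ = -(Matrix.of fun i j => entry k β.carrier (R i) (C j)).det := by
  have hm : m = (θ.carrier \ β.carrier).card := by
    rw [h1, Finset.card_image_of_injective _ hR.injective, Finset.card_univ, Fintype.card_fin]
  subst hm
  have e1 : R ∘ Fin.rev = (θ.carrier \ β.carrier).orderEmbOfFin rfl := by
    apply Finset.orderEmbOfFin_unique
    · intro i
      exact (Finset.ext_iff.1 h1 _).2 (Finset.mem_image_of_mem _ (mem_univ _))
    · exact hR.comp Fin.rev_strictAnti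
  have e2 : C = (β.carrier \ θ.carrier).orderEmbOfFin (card_sdiff_eq β θ) := by
    apply Finset.orderEmbOfFin_unique
    · intro i
      exact (Finset.ext_iff.1 h2 _).2 (Finset.mem_image_of_mem _ (mem_univ _))
    · exact hC
  have : minor k β θ = ((Matrix.of fun i j => entry k β.carrier (R i) (C j)).submatrix
      (Fin.revPerm) id).det := by
    unfold minor
    rw [← e1, ← e2]
    rfl
  rw [this, Matrix.det_permute]
  rcases Int.units_eq_one_or (Equiv.Perm.sign
    (Fin.revPerm (n := (θ.carrier \ β.carrier).card))) with h | h
  · left; rw [h]; simp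
  · right; rw [h]; simp

end Chain

theorem degree_minor (k : Type*) [Field k] {d m : ℕ} {β : Idx d} (hβ : β.IsIsotropic)
    {R C : Fin m → Fin (2 * d)} (hR : StrictAnti R) (hC : StrictMono C)
    (hp : ∀ i j, IsRoot β.carrier (R i, C j)) (hu : ∀ i, R i ≤ (C i).rev) (θ : Idx d)
    (h1 : θ.carrier \ β.carrier = univ.image R) (h2 : β.carrier \ θ.carrier = univ.image C) :
    minor k β θ ≠ 0 ∧ (termOrder β.carrier).degree (minor k β θ) =
      ∑ i, Finsupp.single (rootVar hβ (R i, C i) (hp i i)) 1 := by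
  choose a ha hM using fun i j => entry_eq_monomial k hβ (R i) (C j) (hp i j)
  obtain ⟨hne, hdeg⟩ := degree_det_monomial (rootVar_diag_strictMono hβ hR hp hu)
    (w := fun i j => rootVar hβ (R i, C j) (hp i j)) (fun _ => rfl)
    (fun i j hij => rootVar_diag_lt hβ hR hC hp hu hij) (fun i => ha i i)
    (M := Matrix.of fun i j => entry k β.carrier (R i) (C j)) hM
  rcases minor_eq_det k θ hR hC h1 h2 with h | h
  · rw [h]
    exact ⟨hne, hdeg⟩
  · rw [h]
    exact ⟨neg_ne_zero.2 hne, MonomialOrder.degree_neg.trans hdeg⟩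

/-- The minor whose rows and columns are obtained from those of a chain of upper roots by `#`. -/
theorem degree_minor_hash (k : Type*) [Field k] {d m : ℕ} {β : Idx d} (hβ : β.IsIsotropic)
    {R C : Fin m → Fin (2 * d)} (hR : StrictAnti R) (hC : StrictMono C)
    (hp : ∀ i j, IsRoot β.carrier (R i, C j)) (hu : ∀ i, R i ≤ (C i).rev) (θ : Idx d)
    (h1 : θ.carrier \ β.carrier = univ.image fun i => (C i).rev)
    (h2 : β.carrier \ θ.carrier = univ.image fun i => (R i).rev) :
    minor k β θ ≠ 0 ∧ (termOrder β.carrier).degree (minor k β θ) =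
      ∑ i, Finsupp.single (rootVar hβ (R i, C i) (hp i i)) 1 := by
  -- The `(i, j)` entry lies at the root `#(R j, C i)`, so up to signs of entries this is the
  -- transpose of the matrix of the original chain.
  choose a ha hM using fun i j =>
    entry_eq_monomial k hβ (C i).rev (R j).rev (isRoot_hash hβ (hp j i))
  obtain ⟨hne, hdeg⟩ := degree_det_monomial (rootVar_diag_strictMono hβ hR hp hu)
    (w := fun i j => rootVar hβ (hash (R j, C i)) (isRoot_hash hβ (hp j i)))
    (fun i => rootVar_hash hβ _ _)
    (fun i j hij => by
      rw [rootVar_hash, min_comm]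
      exact rootVar_diag_lt hβ hR hC hp hu hij.symm) (fun i => ha i i)
    (M := Matrix.of fun i j => entry k β.carrier (C i).rev (R j).rev) hM
  rcases minor_eq_det k θ (R := fun i => (C i).rev) (C := fun i => (R i).rev)
    (fun i j hij => Fin.rev_lt_rev.2 (hC hij)) (fun i j hij => Fin.rev_lt_rev.2 (hR hij))
    h1 h2 with h | h
  · rw [h]
    exact ⟨hne, hdeg⟩
  · rw [h]
    exact ⟨neg_ne_zero.2 hne, MonomialOrder.degree_neg.trans hdeg⟩

/-! ### Termwise comparison through counting functions -/

theorem countP_le_of_forall₂ {n : ℕ} {l₁ l₂ : List (Fin n)} (h : List.Forall₂ (· ≤ ·) l₁ l₂)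
    (x : ℕ) : l₂.countP (fun a => a.val < x) ≤ l₁.countP (fun a => a.val < x) := by
  induction h with
  | nil => simp
  | @cons a b l₁ l₂ hab _ ih =>
    have hab' : a.val ≤ b.val := hab
    simp only [List.countP_cons, decide_eq_true_eq]
    split_ifs <;> omega

/-- If the heads satisfied `b < a`, sortedness would leave no element of the first list below `b +
1`, against the count there. For the tails, the only problematic thresholds are those `≤ b`, where
the second count vanishes. -/
theorem forall₂_of_countP_le {n : ℕ} {l₁ l₂ : List (Fin n)} (h₁ : l₁.Pairwise (· ≤ ·))
    (h₂ : l₂.Pairwise (· ≤ ·)) (hl : l₁.length = l₂.length)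
    (h : ∀ x : ℕ, l₂.countP (fun a => a.val < x) ≤ l₁.countP (fun a => a.val < x)) :
    List.Forall₂ (· ≤ ·) l₁ l₂ := by
  induction l₁ generalizing l₂ with
  | nil =>
    rw [List.eq_nil_of_length_eq_zero hl.symm]
    exact List.Forall₂.nil
  | cons a l₁ ih =>
    cases l₂ with
    | nil => simp at hl
    | cons b l₂ =>
      rw [List.pairwise_cons] at h₁ h₂
      have hab : a.val ≤ b.val := by
        by_contra! hlt
        have := h (b.val + 1)
        have h0 : l₁.countP (fun a => a.val < b.val + 1) = 0 := by
          rw [List.countP_eq_zero]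
          intro c hc
          have : a.val ≤ c.val := h₁.1 c hc
          simp only [decide_eq_true_eq]
          omega
        simp only [List.countP_cons, decide_eq_true_eq, h0] at this
        split_ifs at this <;> omega
      refine List.Forall₂.cons hab (ih h₁.2 h₂.2 (by simpa using hl) fun x => ?_)
      have := h x
      simp only [List.countP_cons, decide_eq_true_eq] at this
      by_cases hb : b.val < x
      · split_ifs at this <;> omega
      · have h0 : l₂.countP (fun a => a.val < x) = 0 := by
          rw [List.countP_eq_zero]
          intro c hc
          have : b.val ≤ c.val := h₂.1 c hc
          simp only [decide_eq_true_eq]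
          omega
        omega

theorem termLE_iff {n : ℕ} {A B : Multiset (Fin n)} :
    TermLE A B ↔ A.card = B.card ∧
      ∀ x : ℕ, B.countP (fun a => a.val < x) ≤ A.countP (fun a => a.val < x) := by
  have hc : ∀ (A : Multiset (Fin n)) (x : ℕ), A.countP (fun a => a.val < x) =
      (A.sort (· ≤ ·)).countP (fun a => a.val < x) := by
    intro A x
    conv_lhs => rw [← Multiset.sort_eq A (· ≤ ·)]
    rw [Multiset.coe_countP]
  have hl : ∀ A : Multiset (Fin n), A.card = (A.sort (· ≤ ·)).length := fun A =>
    (Multiset.length_sort _).symm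
  simp only [hc, hl]
  exact ⟨fun h => ⟨h.length_eq, countP_le_of_forall₂ h⟩, fun h =>
    forall₂_of_countP_le (Multiset.pairwise_sort _ _) (Multiset.pairwise_sort _ _) h.1 h.2⟩

/-- The number of elements of `A` among the first `x` indices. -/
def cnt {n : ℕ} (A : Finset (Fin n)) (x : ℕ) : ℕ := (A.filter fun a => a.val < x).card

theorem countP_val {n : ℕ} (A : Finset (Fin n)) (x : ℕ) :
    A.val.countP (fun a => a.val < x) = cnt A x := by
  rw [Multiset.countP_eq_card_filter]
  rfl

theorem termLE_val_iff {n : ℕ} {A B : Finset (Fin n)} (h : A.card = B.card) :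
    TermLE A.val B.val ↔ ∀ x, cnt B x ≤ cnt A x := by
  simp only [termLE_iff, countP_val]
  exact and_iff_right h

theorem Idx.le_iff {d : ℕ} {θ φ : Idx d} :
    θ ≤ φ ↔ ∀ x, cnt φ.carrier x ≤ cnt θ.carrier x :=
  termLE_val_iff (θ.card_carrier.trans φ.card_carrier.symm)

theorem cnt_sdiff_add_inter {n : ℕ} (A B : Finset (Fin n)) (x : ℕ) :
    cnt (A \ B) x + cnt (A ∩ B) x = cnt A x := by
  unfold cnt
  rw [← Finset.card_union_of_disjoint, ← Finset.filter_union, Finset.sdiff_union_inter]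
  exact Finset.disjoint_filter_filter (Finset.disjoint_sdiff_inter A B)

theorem cnt_sdiff_add {n : ℕ} (A B : Finset (Fin n)) (x : ℕ) :
    cnt (A \ B) x + cnt B x = cnt (B \ A) x + cnt A x := by
  have h1 := cnt_sdiff_add_inter A B x
  have h2 := cnt_sdiff_add_inter B A x
  rw [Finset.inter_comm] at h2
  omega

theorem cnt_univ {n x : ℕ} (hx : x ≤ n) : cnt (univ : Finset (Fin n)) x = x := by
  rw [cnt, Fin.card_filter_val_lt, min_eq_right hx]

theorem cnt_compl {n x : ℕ} (hx : x ≤ n) (A : Finset (Fin n)) : cnt Aᶜ x + cnt A x = x := by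
  have := cnt_sdiff_add_inter univ A x
  rw [Finset.univ_inter, cnt_univ hx] at this
  rwa [Finset.compl_eq_univ_sdiff]

theorem cnt_image_rev {n x : ℕ} (hx : x ≤ n) (A : Finset (Fin n)) :
    cnt (A.image Fin.rev) x + cnt A (n - x) = A.card := by
  have : cnt (A.image Fin.rev) x = (A.filter fun a => ¬ a.val < n - x).card := by
    unfold cnt
    rw [Finset.filter_image, Finset.card_image_of_injective _ Fin.rev_injective]
    congr 1
    ext a
    simp only [Finset.mem_filter, Fin.val_rev]
    have := a.isLt
    refine and_congr_right fun _ => ?_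
    omega
  rw [this, add_comm]
  exact Finset.card_filter_add_card_filter_not _

theorem mem_image_rev {n : ℕ} (A : Finset (Fin n)) (i : Fin n) :
    i ∈ A.image Fin.rev ↔ i.rev ∈ A := by
  simp only [Finset.mem_image]
  constructor
  · rintro ⟨a, ha, rfl⟩
    rwa [Fin.rev_rev]
  · exact fun h => ⟨_, h, Fin.rev_rev i⟩

theorem compl_eq_image_rev {n : ℕ} {A : Finset (Fin n)} (hA : ∀ i, i ∈ A ↔ i.rev ∉ A) :
    Aᶜ = A.image Fin.rev := by
  ext i
  rw [mem_image_rev, Finset.mem_compl, hA, not_not]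

theorem card_of_isotropic {d : ℕ} {A : Finset (Fin (2 * d))} (hA : ∀ i, i ∈ A ↔ i.rev ∉ A) :
    A.card = d := by
  have h1 := Finset.card_compl_add_card A
  rw [compl_eq_image_rev hA, Finset.card_image_of_injective _ Fin.rev_injective,
    Fintype.card_fin] at h1
  omega

/-- The complement of an isotropic set is its reflection. This symmetry lets inequalities be
transported between the thresholds `x` and `2d - x`. -/
theorem cnt_isotropic {d x : ℕ} (hx : x ≤ 2 * d) {A : Finset (Fin (2 * d))}
    (hA : ∀ i, i ∈ A ↔ i.rev ∉ A) : cnt A x + d = x + cnt A (2 * d - x) := by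
  have h1 := cnt_compl hx A
  have h2 := cnt_image_rev hx A
  rw [compl_eq_image_rev hA] at h1
  rw [card_of_isotropic hA] at h2
  omega

theorem cnt_of_ge {n x : ℕ} (hx : n ≤ x) (A : Finset (Fin n)) : cnt A x = A.card := by
  unfold cnt
  rw [Finset.filter_true_of_mem fun a _ => a.isLt.trans_le hx]

theorem cnt_congr {n x : ℕ} {A B : Finset (Fin n)} (h : ∀ i : Fin n, i.val < x → (i ∈ A ↔ i ∈ B)) :
    cnt A x = cnt B x := by
  unfold cnt
  congr 1
  ext i
  simp only [Finset.mem_filter]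
  exact and_congr_left fun hi => h i hi

/-! ### Admissible pairs from a single index -/

/-- The two members are forced: `t` extends the lower half of `θ` isotropically, and `u` extends the
upper half. The hypothesis says exactly that `u ≤ t` holds at thresholds up to `d`; isotropy gives
the rest. -/
theorem exists_admissiblePair {d : ℕ} (θ : Idx d)
    (h : ∀ z ≤ d, cnt θ.carrier z + d ≤ z + cnt θ.carrier (2 * d - z)) :
    ∃ w : AdmissiblePair d, w.theta = θ ∧
      (∀ z ≤ d, cnt w.top.carrier z = cnt θ.carrier z) ∧
      (∀ z, d ≤ z → cnt w.bot.carrier z = cnt θ.carrier z) := by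
  classical
  obtain ⟨A, hcard⟩ := θ
  simp only at h
  set t : Finset (Fin (2 * d)) :=
    univ.filter fun i => (i.val < d ∧ i ∈ A) ∨ (¬ i.val < d ∧ i.rev ∉ A) with ht
  set u : Finset (Fin (2 * d)) :=
    univ.filter fun i => (i.val < d ∧ i.rev ∉ A) ∨ (¬ i.val < d ∧ i ∈ A) with hu
  have hti : ∀ i, i ∈ t ↔ i.rev ∉ t := by
    intro i
    have hi := i.isLt
    have h1 : (2 * d - (i.val + 1) < d) ↔ ¬ i.val < d := by omega
    simp only [ht, Finset.mem_filter, mem_univ, true_and, Fin.val_rev, Fin.rev_rev, h1]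
    tauto
  have hui : ∀ i, i ∈ u ↔ i.rev ∉ u := by
    intro i
    have hi := i.isLt
    have h1 : (2 * d - (i.val + 1) < d) ↔ ¬ i.val < d := by omega
    simp only [hu, Finset.mem_filter, mem_univ, true_and, Fin.val_rev, Fin.rev_rev, h1]
    tauto
  have htc : ∀ z ≤ d, cnt t z = cnt A z := fun z hz => cnt_congr fun i hi => by
    have : i.val < d := by omega
    simp [ht, this]
  have huc' : ∀ z ≤ d, cnt u z + d = z + cnt A (2 * d - z) := by
    intro z hz
    -- Below `d`, the set `u` is the complement of the reflection of `θ`.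
    have h1 : cnt u z = cnt (A.image Fin.rev)ᶜ z := cnt_congr fun i hi => by
      have : i.val < d := by omega
      simp only [hu, Finset.mem_filter, mem_univ, true_and, this, Finset.mem_compl, mem_image_rev]
      tauto
    have h2 := cnt_compl (show z ≤ 2 * d by omega) (A.image Fin.rev)
    have h3 := cnt_image_rev (show z ≤ 2 * d by omega) A
    omega
  have huc : ∀ z, d ≤ z → cnt u z = cnt A z := by
    intro z hz
    rcases le_or_gt z (2 * d) with hz2 | hz2
    · have h1 := cnt_isotropic hz2 hui
      have h2 := huc' (2 * d - z) (by omega)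
      rw [show 2 * d - (2 * d - z) = z by omega] at h2
      omega
    · rw [cnt_of_ge hz2.le, cnt_of_ge hz2.le, card_of_isotropic hui, hcard]
  have heps : ∀ B : Finset (Fin (2 * d)), (B \ eps d).card + cnt B d = B.card := by
    intro B
    have : cnt B d = (B ∩ eps d).card := by
      unfold cnt eps
      congr 1
      ext i
      simp
    rw [this]
    exact Finset.card_sdiff_add_card_inter B (eps d)
  have hle : ∀ z, cnt t z ≤ cnt u z := by
    have key : ∀ z ≤ d, cnt t z ≤ cnt u z := by
      intro z hz
      have h1 := htc z hz
      have h2 := huc' z hz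
      have h3 := h z hz
      omega
    intro z
    rcases le_or_gt z d with hz | hz
    · exact key z hz
    rcases le_or_gt z (2 * d) with hz2 | hz2
    · have h1 := cnt_isotropic hz2 hui
      have h2 := cnt_isotropic hz2 hti
      have h3 := key (2 * d - z) (by omega)
      omega
    · rw [cnt_of_ge hz2.le, cnt_of_ge hz2.le, card_of_isotropic hui, card_of_isotropic hti]
  refine ⟨⟨⟨t, card_of_isotropic hti⟩, ⟨u, card_of_isotropic hui⟩, hti, hui,
    Idx.le_iff.2 hle, ?_⟩, ?_, htc, huc⟩
  · have h1 := heps t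
    have h2 := heps u
    rw [card_of_isotropic hti, htc d le_rfl] at h1
    rw [card_of_isotropic hui, huc d le_rfl] at h2
    change (t \ eps d).card = (u \ eps d).card
    omega
  · unfold AdmissiblePair.theta
    congr 1
    ext i
    simp only [ht, hu, eps, Finset.mem_union, Finset.mem_inter, Finset.mem_sdiff, Finset.mem_filter,
      mem_univ, true_and]
    tauto

/-! ### Weights of chains given as sequences -/

/-- The number of terms of the sequence `f` among the first `x` indices. -/
def numLt {m n : ℕ} (f : Fin m → Fin n) (x : ℕ) : ℕ := ∑ i, if (f i).val < x then 1 else 0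

theorem cnt_image {m n : ℕ} {f : Fin m → Fin n} (hf : Function.Injective f) (x : ℕ) :
    cnt (univ.image f) x = numLt f x := by
  unfold cnt numLt
  rw [Finset.filter_image, Finset.card_image_of_injective _ hf, Finset.card_filter]

theorem exists_weight {d m : ℕ} {β : Idx d} {R C : Fin m → Fin (2 * d)}
    (hR : Function.Injective R) (hC : Function.Injective C) (hRβ : ∀ i, R i ∉ β.carrier)
    (hCβ : ∀ i, C i ∈ β.carrier) :
    ∃ θ : Idx d, θ.carrier = (β.carrier \ univ.image C) ∪ univ.image R ∧
      θ.carrier \ β.carrier = univ.image R ∧ β.carrier \ θ.carrier = univ.image C ∧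
      ∀ z, cnt θ.carrier z + numLt C z = cnt β.carrier z + numLt R z := by
  have hRd : Disjoint (univ.image R) β.carrier := by
    rw [Finset.disjoint_left]
    intro a ha
    obtain ⟨i, _, rfl⟩ := Finset.mem_image.1 ha
    exact hRβ i
  have hCs : univ.image C ⊆ β.carrier := by
    intro a ha
    obtain ⟨i, _, rfl⟩ := Finset.mem_image.1 ha
    exact hCβ i
  have hcard : ((β.carrier \ univ.image C) ∪ univ.image R).card = d := by
    rw [Finset.card_union_of_disjoint (hRd.symm.mono_left Finset.sdiff_subset),
      Finset.card_sdiff_of_subset hCs, Finset.card_image_of_injective _ hR,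
      Finset.card_image_of_injective _ hC, β.card_carrier]
    have := Finset.card_le_card hCs
    rw [Finset.card_image_of_injective _ hC, β.card_carrier] at this
    omega
  have h1 : ((β.carrier \ univ.image C) ∪ univ.image R) \ β.carrier = univ.image R := by
    ext a
    have : a ∈ univ.image R → a ∉ β.carrier := fun h => Finset.disjoint_left.1 hRd h
    simp only [Finset.mem_sdiff, Finset.mem_union]
    tauto
  have h2 : β.carrier \ ((β.carrier \ univ.image C) ∪ univ.image R) = univ.image C := by
    ext a
    have h3 : a ∈ univ.image R → a ∉ β.carrier := fun h => Finset.disjoint_left.1 hRd h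
    have h4 := @hCs a
    simp only [Finset.mem_sdiff, Finset.mem_union]
    tauto
  refine ⟨⟨_, hcard⟩, rfl, h1, h2, fun z => ?_⟩
  have h3 := cnt_sdiff_add ((β.carrier \ univ.image C) ∪ univ.image R) β.carrier z
  rw [h1, h2, cnt_image hR, cnt_image hC] at h3
  change cnt ((β.carrier \ univ.image C) ∪ univ.image R) z + _ = _
  omega

/-- The indicator condition on the members of a chain under which its weight comes from an
admissible pair. -/
theorem exists_admissiblePair_weight {d m : ℕ} {β θ : Idx d} (hβ : β.IsIsotropic)
    {R C : Fin m → Fin (2 * d)}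
    (hθ : ∀ z, cnt θ.carrier z + numLt C z = cnt β.carrier z + numLt R z)
    (h : ∀ z ≤ d, ∀ i, (2 * d - z ≤ (R i).val ∨ (R i).val < z) →
      2 * d - z ≤ (C i).val ∨ (C i).val < z) :
    ∃ w : AdmissiblePair d, w.theta = θ ∧
      (∀ z ≤ d, cnt w.top.carrier z = cnt θ.carrier z) ∧
      (∀ z, d ≤ z → cnt w.bot.carrier z = cnt θ.carrier z) := by
  apply exists_admissiblePair
  intro z hz
  have h1 := hθ z
  have h2 := hθ (2 * d - z)
  have h3 := cnt_isotropic (show z ≤ 2 * d by omega) hβ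
  have h4 : numLt R z + numLt C (2 * d - z) ≤ numLt C z + numLt R (2 * d - z) := by
    unfold numLt
    rw [← Finset.sum_add_distrib, ← Finset.sum_add_distrib]
    refine Finset.sum_le_sum fun i _ => ?_
    have := h z hz i
    split_ifs <;> omega
  omega

theorem numLt_eq_card {m n x : ℕ} {f : Fin m → Fin n} (h : ∀ i, (f i).val < x) :
    numLt f x = m := by
  simp [numLt, h]

theorem numLt_eq_zero {m n x : ℕ} {f : Fin m → Fin n} (h : ∀ i, x ≤ (f i).val) :
    numLt f x = 0 := by
  simp [numLt, fun i => not_lt.2 (h i)]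

theorem isExtChain_image {m n : ℕ} {R C : Fin m → Fin n} (hR : StrictAnti R) (hC : StrictMono C) :
    IsExtChain (univ.image fun i => (R i, C i)) := by
  intro p hp q hq hpq
  obtain ⟨i, _, rfl⟩ := Finset.mem_image.1 hp
  obtain ⟨j, _, rfl⟩ := Finset.mem_image.1 hq
  rcases lt_trichotomy i j with h | rfl | h
  · exact Or.inl ⟨hR h, hC h⟩
  · exact absurd rfl hpq
  · exact Or.inr ⟨hR h, hC h⟩

theorem chainWeight_image {m n : ℕ} (β : Finset (Fin n)) (R C : Fin m → Fin n) :
    chainWeight β (univ.image fun i => (R i, C i)) = (β \ univ.image C) ∪ univ.image R := by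
  unfold chainWeight
  rw [Finset.image_image, Finset.image_image]
  rfl

theorem initFormsChain_of_degree {k : Type*} [Field k] {d m : ℕ} {β : Idx d}
    (hβ : β.IsIsotropic) {R C : Fin m → Fin (2 * d)} (hR : StrictAnti R) (hC : StrictMono C)
    (hp : ∀ i j, IsRoot β.carrier (R i, C j)) (hu : ∀ i, R i ≤ (C i).rev)
    {f : CoordRing k β.carrier} (hf : (termOrder β.carrier).degree f =
      ∑ i, Finsupp.single (rootVar hβ (R i, C i) (hp i i)) 1) :
    InitFormsChain f (univ.image fun i => (R i, C i)) := by
  refine ⟨isExtChain_image hR hC, ?_⟩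
  have hinj : Function.Injective fun i => (R i, C i) := fun i j hij =>
    hR.injective (congrArg Prod.fst hij)
  rw [hf, Finsupp.toMultiset_sum, Finset.image_val_of_injOn hinj.injOn]
  simp only [Finsupp.toMultiset_single, one_smul]
  have hsum : (∑ i, ({rootVar hβ (R i, C i) (hp i i)} : Multiset (UpperRoot β.carrier))) =
      univ.val.map fun i => rootVar hβ (R i, C i) (hp i i) := by
    rw [← Multiset.sum_map_singleton (univ.val.map _), Multiset.map_map]
    rfl
  rw [hsum, Multiset.map_map]
  refine Multiset.map_congr rfl fun i _ => ?_
  rw [Function.comp_apply, rootVar_pair, if_pos (hu i)]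

/-! ### Membership in the initial ideal -/

theorem monomial_mem_initialIdeal {k : Type*} [Field k] {n : ℕ} {β : Finset (Fin n)}
    {S : Set (CoordRing k β)} {f : CoordRing k β} (hf : f ∈ S) (hf0 : f ≠ 0)
    {U : UpperRoot β →₀ ℕ} (hU : (termOrder β).degree f ≤ U) :
    MvPolynomial.monomial U (1 : k) ∈ initialIdeal S := by
  have hlc : (termOrder β).leadingCoeff f ≠ 0 :=
    (termOrder β).leadingCoeff_ne_zero_iff.2 hf0
  have : MvPolynomial.monomial U (1 : k) =
      MvPolynomial.monomial (U - (termOrder β).degree f) ((termOrder β).leadingCoeff f)⁻¹ *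
        (termOrder β).leadingTerm f := by
    unfold MonomialOrder.leadingTerm
    rw [MvPolynomial.monomial_mul, tsub_add_cancel_of_le hU, inv_mul_cancel₀ hlc]
  rw [this]
  exact Ideal.mul_mem_left _ _ (Ideal.subset_span (Set.mem_image_of_mem _ hf))

theorem sum_single_le {σ : Type*} {m : ℕ} {v : Fin m → σ} (hv : Function.Injective v)
    {U : σ →₀ ℕ} (hU : ∀ i, v i ∈ U.support) : ∑ i, Finsupp.single (v i) 1 ≤ U := by
  classical
  intro s
  rw [Finsupp.finsetSum_apply]
  by_cases hs : ∃ i, v i = s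
  · obtain ⟨i, rfl⟩ := hs
    rw [Finset.sum_eq_single i]
    · rw [Finsupp.single_eq_same]
      exact Nat.one_le_iff_ne_zero.2 (Finsupp.mem_support_iff.1 (hU i))
    · intro j _ hj
      exact Finsupp.single_eq_of_ne fun h => hj (hv h).symm
    · simp
  · push Not at hs
    rw [Finset.sum_eq_zero fun i _ => Finsupp.single_eq_of_ne (hs i).symm]
    exact Nat.zero_le _

/-! ### From a violated bound to a good admissible pair -/

section Violation

variable {k : Type*} [Field k] {d m : ℕ} {α β γ : Idx d} {R C : Fin m → Fin (2 * d)}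
  {U : UpperRoot β.carrier →₀ ℕ} {x : ℕ}

theorem monomial_mem_of_minor (hβ : β.IsIsotropic) (hR : StrictAnti R)
    (hp : ∀ i j, IsRoot β.carrier (R i, C j)) (hu : ∀ i, R i ≤ (C i).rev)
    (hU : ∀ i, rootVar hβ (R i, C i) (hp i i) ∈ U.support) {w : AdmissiblePair d}
    (hw : IsGood k α β γ w) (h : pairMinor k β w ≠ 0 ∧
      (termOrder β.carrier).degree (pairMinor k β w) =
        ∑ i, Finsupp.single (rootVar hβ (R i, C i) (hp i i)) 1) :
    MvPolynomial.monomial U (1 : k) ∈ initialIdeal (goodSet k α β γ) := by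
  have hS : pairMinor k β w ∈ goodSet k α β γ := ⟨w, hw, rfl⟩
  refine monomial_mem_initialIdeal hS h.1 ?_
  rw [h.2]
  exact sum_single_le (rootVar_diag_strictMono hβ hR hp hu).injective hU

/-- At `x` every column index of the chain is lost and no row index gained, so the weight `θ` has
too few elements there to be `≤ γ`. As `x ≤ d`, the top of the pair has the same count, so both
goodness conditions fail at the same threshold against `γ`. -/
theorem monomial_mem_of_posViolation (hβ : β.IsIsotropic) (hR : StrictAnti R) (hC : StrictMono C)
    (hp : ∀ i j, IsRoot β.carrier (R i, C j)) (hu : ∀ i, R i ≤ (C i).rev)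
    (hU : ∀ i, rootVar hβ (R i, C i) (hp i i) ∈ U.support) (hx : x ≤ d)
    (hCx : ∀ i, (C i).val < x) (hRx : ∀ i, x ≤ (R i).val)
    (hlt : cnt β.carrier x < cnt γ.carrier x + m) :
    MvPolynomial.monomial U (1 : k) ∈ initialIdeal (goodSet k α β γ) := by
  obtain ⟨θ, hθ, h1, h2, hcnt⟩ := exists_weight (β := β) hR.injective hC.injective
    (fun i => (hp i i).1) (fun i => (hp i i).2)
  -- If `R i < z` then `C i < x ≤ R i < z`; if `R i ≥ 2d - z` then `R i ≤ (C i)*` forces `C i < z`.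
  obtain ⟨w, rfl, htop, -⟩ := exists_admissiblePair_weight hβ hcnt (by
    intro z hz i h
    have hi := hu i
    rw [Fin.le_def, Fin.val_rev] at hi
    have := (C i).isLt
    have := hCx i
    have := hRx i
    omega)
  have hviol : cnt w.theta.carrier x < cnt γ.carrier x := by
    have := hcnt x
    rw [numLt_eq_card hCx, numLt_eq_zero hRx] at this
    omega
  have hdeg := degree_minor k hβ hR hC hp hu w.theta h1 h2
  refine monomial_mem_of_minor hβ hR hp hu hU (w := w) ⟨Or.inr ?_, Or.inl
    ⟨_, initFormsChain_of_degree hβ hR hC hp hu hdeg.2, ?_, ?_⟩⟩ hdeg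
  · rw [Idx.le_iff]
    intro h
    have := h x
    rw [htop x hx] at this
    omega
  · unfold posPart
    rw [Finset.filter_eq_self]
    intro p hp
    obtain ⟨i, _, rfl⟩ := Finset.mem_image.1 hp
    exact Fin.lt_def.2 ((hCx i).trans_le (hRx i))
  · rw [chainWeight_image, ← hθ]
    intro h
    have := Idx.le_iff.1 h x
    omega

/-- Two weights occur. `φ`, of the upper chain formed by the initial term, violates the bound by `α`
at `x`. `θ`, of the reflected chain, yields the admissible pair and violates it at `2d - x ≥ d`,
where the bottom of the pair has the counts of `θ`. For `φ` itself the criterion for an admissible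
pair can fail. -/
theorem monomial_mem_of_negViolation (hα : α.IsIsotropic) (hβ : β.IsIsotropic)
    (hR : StrictAnti R) (hC : StrictMono C)
    (hp : ∀ i j, IsRoot β.carrier (R i, C j)) (hu : ∀ i, R i ≤ (C i).rev)
    (hU : ∀ i, rootVar hβ (R i, C i) (hp i i) ∈ U.support) (hx : x ≤ d)
    (hRx : ∀ i, (R i).val < x) (hCx : ∀ i, x ≤ (C i).val)
    (hlt : cnt α.carrier x < cnt β.carrier x + m) :
    MvPolynomial.monomial U (1 : k) ∈ initialIdeal (goodSet k α β γ) := by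
  have hRx' : ∀ i, 2 * d - x ≤ (R i).rev.val := fun i => by
    have := hRx i
    rw [Fin.val_rev]
    omega
  have hCx' : ∀ i, (C i).rev.val < 2 * d - x := fun i => by
    have := hCx i
    have := (C i).isLt
    rw [Fin.val_rev]
    omega
  obtain ⟨φ, hφ, -, -, hφcnt⟩ := exists_weight (β := β) hR.injective hC.injective
    (fun i => (hp i i).1) (fun i => (hp i i).2)
  obtain ⟨θ, -, h1, h2, hcnt⟩ := exists_weight (β := β) (R := fun i => (C i).rev)
    (C := fun i => (R i).rev) (Fin.rev_injective.comp hC.injective)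
    (Fin.rev_injective.comp hR.injective)
    (fun i => (isRoot_hash hβ (hp i i)).1) (fun i => (isRoot_hash hβ (hp i i)).2)
  -- Whether `C i < z` or `(C i)* < z`, the inequalities `R i < x ≤ C i` and `R i ≤ (C i)*` give `R
  -- i < z`, that is, `(R i)* ≥ 2d - z`.
  obtain ⟨w, rfl, -, hbot⟩ := exists_admissiblePair_weight hβ hcnt (by
    intro z hz i h
    have hi := hu i
    rw [Fin.le_def] at hi
    have := (R i).isLt
    have := (C i).isLt
    have := hCx i
    have := hRx i
    simp only [Fin.val_rev] at h hi ⊢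
    omega)
  have hdeg := degree_minor_hash k hβ hR hC hp hu w.theta h1 h2
  refine monomial_mem_of_minor hβ hR hp hu hU (w := w) ⟨Or.inl ?_, Or.inr
    ⟨_, initFormsChain_of_degree hβ hR hC hp hu hdeg.2, ?_, ?_⟩⟩ hdeg
  · rw [Idx.le_iff]
    intro h
    have h3 := h (2 * d - x)
    have h4 := hcnt (2 * d - x)
    rw [hbot _ (by omega)] at h3
    rw [numLt_eq_card hCx', numLt_eq_zero hRx'] at h4
    have h5 := cnt_isotropic (show x ≤ 2 * d by omega) hα
    have h6 := cnt_isotropic (show x ≤ 2 * d by omega) hβ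
    omega
  · unfold negPart
    rw [Finset.filter_eq_self]
    intro p hp
    obtain ⟨i, _, rfl⟩ := Finset.mem_image.1 hp
    exact Fin.lt_def.2 ((hRx i).trans_le (hCx i))
  · rw [chainWeight_image, ← hφ]
    intro h
    have h3 := Idx.le_iff.1 h x
    have h4 := hφcnt x
    rw [numLt_eq_card hRx, numLt_eq_zero hCx] at h4
    omega

end Violation

/-! ### Chains in the doubled multiset -/

theorem exists_sequence {n : ℕ} {E : Finset (Fin n × Fin n)} (hE : IsExtChain E) :
    ∃ R C : Fin E.card → Fin n, StrictAnti R ∧ StrictMono C ∧ ∀ i, (R i, C i) ∈ E := by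
  have hinj : Set.InjOn Prod.snd (E : Set (Fin n × Fin n)) := by
    intro p hp q hq h
    by_contra hne
    rcases hE hp hq hne with h' | h'
    · exact h'.2.ne h
    · exact h'.2.ne h.symm
  have hcard : (E.image Prod.snd).card = E.card := Finset.card_image_of_injOn hinj
  set C := (E.image Prod.snd).orderEmbOfFin hcard with hC
  have hmem : ∀ i, ∃ r, (r, C i) ∈ E := by
    intro i
    obtain ⟨p, hp, h⟩ := Finset.mem_image.1 ((E.image Prod.snd).orderEmbOfFin_mem hcard i)
    refine ⟨p.1, ?_⟩
    rw [hC, ← h]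
    exact hp
  choose R hRE using hmem
  refine ⟨R, C, fun i j hij => ?_, C.strictMono, hRE⟩
  have hlt : C i < C j := C.strictMono hij
  rcases hE (hRE i) (hRE j) (fun h => hlt.ne (congrArg Prod.snd h)) with h | h
  · exact h.1
  · exact absurd h.2 hlt.not_gt

theorem mem_doubling {n : ℕ} {β : Finset (Fin n)} {U : UpperRoot β →₀ ℕ} {p : Fin n × Fin n} :
    p ∈ doubling U ↔ ∃ q ∈ U.support, q.pair = p ∨ q.pair = hash p := by
  simp only [doubling, Multiset.mem_add, Multiset.mem_map, Finsupp.mem_toMultiset]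
  constructor
  · rintro (⟨q, hq, rfl⟩ | ⟨_, ⟨q, hq, rfl⟩, rfl⟩)
    · exact ⟨q, hq, Or.inl rfl⟩
    · exact ⟨q, hq, Or.inr (hash_hash _).symm⟩
  · rintro ⟨q, hq, rfl | h⟩
    · exact Or.inl ⟨q, hq, rfl⟩
    · exact Or.inr ⟨_, ⟨q, hq, rfl⟩, by rw [h, hash_hash]⟩

theorem isRoot_of_mem_doubling {d : ℕ} {β : Idx d} (hβ : β.IsIsotropic)
    {U : UpperRoot β.carrier →₀ ℕ} {p : Fin (2 * d) × Fin (2 * d)} (hp : p ∈ doubling U) :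
    IsRoot β.carrier p := by
  obtain ⟨q, _, h | h⟩ := mem_doubling.1 hp
  · exact h ▸ q.isUpperRoot.1
  · rw [← hash_hash p, ← h]
    exact isRoot_hash hβ q.isUpperRoot.1

theorem rootVar_mem_support {d : ℕ} {β : Idx d} (hβ : β.IsIsotropic)
    {U : UpperRoot β.carrier →₀ ℕ} {p : Fin (2 * d) × Fin (2 * d)} (hp : p ∈ doubling U)
    (hr : IsRoot β.carrier p) : rootVar hβ p hr ∈ U.support := by
  have aux : ∀ q : UpperRoot β.carrier, ∀ h, rootVar hβ q.pair h = q := by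
    intro q h
    apply UpperRoot.pair_injective
    rw [rootVar_pair, if_pos q.isUpperRoot.2]
  obtain ⟨q, hq, rfl | h⟩ := mem_doubling.1 hp
  · rwa [aux]
  · rw [← rootVar_hash]
    have h2 := aux q q.isUpperRoot.1
    simp only [h] at h2
    rwa [h2]

/-- Replacing the members of a chain below the diagonal by their images under `#` gives a chain
of upper roots. -/
theorem exists_folding {d m : ℕ} {β : Idx d} (hβ : β.IsIsotropic) {U : UpperRoot β.carrier →₀ ℕ}
    {R C : Fin m → Fin (2 * d)} (hR : StrictAnti R) (hC : StrictMono C)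
    (hU : ∀ i, (R i, C i) ∈ doubling U) :
    ∃ R' C' : Fin m → Fin (2 * d), StrictAnti R' ∧ StrictMono C' ∧
      ∃ hp : ∀ i j, IsRoot β.carrier (R' i, C' j), (∀ i, R' i ≤ (C' i).rev) ∧
        (∀ i, rootVar hβ (R' i, C' i) (hp i i) ∈ U.support) ∧
        ∀ i, C' i = min (C i) (R i).rev ∧ R' i = (max (C i) (R i).rev).rev := by
  have hfold : ∀ i, ((max (C i) (R i).rev).rev, min (C i) (R i).rev) = (R i, C i) ∨
      ((max (C i) (R i).rev).rev, min (C i) (R i).rev) = hash (R i, C i) := by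
    intro i
    rcases le_total (C i) (R i).rev with h | h
    · left
      rw [max_eq_right h, min_eq_left h, Fin.rev_rev]
    · right
      rw [max_eq_left h, min_eq_right h]
      rfl
  have hD : ∀ i, ((max (C i) (R i).rev).rev, min (C i) (R i).rev) ∈ doubling U := by
    intro i
    rcases hfold i with h | h
    · rw [h]
      exact hU i
    · rw [h, mem_doubling, hash_hash]
      obtain ⟨q, hq, h⟩ := mem_doubling.1 (hU i)
      exact ⟨q, hq, h.symm⟩
  refine ⟨fun i => (max (C i) (R i).rev).rev, fun i => min (C i) (R i).rev, ?_, ?_,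
    fun i j => ⟨(isRoot_of_mem_doubling hβ (hD i)).1, (isRoot_of_mem_doubling hβ (hD j)).2⟩,
    ?_, fun i => rootVar_mem_support hβ (hD i) _, fun i => ⟨rfl, rfl⟩⟩
  -- Along the chain both `C i` and `(R i)*` increase strictly, hence so do their minimum and
  -- maximum; members folded and not folded therefore remain comparable.
  · exact fun i j hij => Fin.rev_lt_rev.2 (max_lt_max (hC hij) (Fin.rev_lt_rev.2 (hR hij)))
  · exact fun i j hij => min_lt_min (hC hij) (Fin.rev_lt_rev.2 (hR hij))
  · exact fun i => Fin.rev_le_rev.2 min_le_max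

section Chains

variable {k : Type*} [Field k] {d : ℕ} {α β γ : Idx d} {U : UpperRoot β.carrier →₀ ℕ} {x : ℕ}
  {E : Finset (Fin (2 * d) × Fin (2 * d))}

theorem monomial_mem_of_posChain (hβ : β.IsIsotropic) (hγ : γ.IsIsotropic) (hE : IsExtChain E)
    (hEU : ∀ p ∈ E, p ∈ doubling U) (hEx : ∀ p ∈ E, p.2.val < x ∧ x ≤ p.1.val)
    (hlt : cnt β.carrier x < cnt γ.carrier x + E.card) :
    MvPolynomial.monomial U (1 : k) ∈ initialIdeal (goodSet k α β γ) := by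
  obtain ⟨R, C, hR, hC, hmem⟩ := exists_sequence hE
  obtain ⟨R', C', hR', hC', hp, hu, hU, hfold⟩ :=
    exists_folding hβ hR hC fun i => hEU _ (hmem i)
  have hx : x ≤ 2 * d := by
    by_contra! hx
    have h0 : E = ∅ := Finset.eq_empty_of_forall_notMem fun p hp => by
      have := hEx p hp
      have := p.1.isLt
      omega
    rw [h0, Finset.card_empty, cnt_of_ge hx.le, cnt_of_ge hx.le, β.card_carrier,
      γ.card_carrier] at hlt
    omega
  -- From `C < x ≤ R` follow `R* < 2d - x ≤ C*`, so the folded root `(min R C*, min C R*)` straddles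
  -- the smaller of `x` and `2d - x`. The difference of the counts of `β` and `γ` is the same at
  -- both.
  refine monomial_mem_of_posViolation (x := min x (2 * d - x)) hβ hR' hC' hp hu hU (by omega)
    ?_ ?_ ?_
  · intro i
    have h1 := hEx _ (hmem i)
    have h2 := (R i).isLt
    rw [(hfold i).1, Fin.coe_min, Fin.val_rev]
    simp only at h1
    omega
  · intro i
    have h1 := hEx _ (hmem i)
    have h2 := (R i).isLt
    have h3 := (C i).isLt
    rw [(hfold i).2, Fin.val_rev, Fin.coe_max, Fin.val_rev]
    simp only at h1
    omega
  · have h1 := cnt_isotropic hx hβ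
    have h2 := cnt_isotropic hx hγ
    rcases le_total x (2 * d - x) with h | h
    · rwa [min_eq_left h]
    · rw [min_eq_right h]
      omega

theorem monomial_mem_of_negChain (hα : α.IsIsotropic) (hβ : β.IsIsotropic) (hE : IsExtChain E)
    (hEU : ∀ p ∈ E, p ∈ doubling U) (hEx : ∀ p ∈ E, p.1.val < x ∧ x ≤ p.2.val)
    (hlt : cnt α.carrier x < cnt β.carrier x + E.card) :
    MvPolynomial.monomial U (1 : k) ∈ initialIdeal (goodSet k α β γ) := by
  obtain ⟨R, C, hR, hC, hmem⟩ := exists_sequence hE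
  obtain ⟨R', C', hR', hC', hp, hu, hU, hfold⟩ :=
    exists_folding hβ hR hC fun i => hEU _ (hmem i)
  have hx : x ≤ 2 * d := by
    by_contra! hx
    have h0 : E = ∅ := Finset.eq_empty_of_forall_notMem fun p hp => by
      have := hEx p hp
      have := p.2.isLt
      omega
    rw [h0, Finset.card_empty, cnt_of_ge hx.le, cnt_of_ge hx.le, β.card_carrier,
      α.card_carrier] at hlt
    omega
  refine monomial_mem_of_negViolation (x := min x (2 * d - x)) hα hβ hR' hC' hp hu hU (by omega)
    ?_ ?_ ?_
  · intro i
    have h1 := hEx _ (hmem i)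
    have h2 := (R i).isLt
    have h3 := (C i).isLt
    rw [(hfold i).2, Fin.val_rev, Fin.coe_max, Fin.val_rev]
    simp only at h1
    omega
  · intro i
    have h1 := hEx _ (hmem i)
    have h2 := (R i).isLt
    rw [(hfold i).1, Fin.coe_min, Fin.val_rev]
    simp only at h1
    omega
  · have h1 := cnt_isotropic hx hα
    have h2 := cnt_isotropic hx hβ
    rcases le_total x (2 * d - x) with h | h
    · rwa [min_eq_left h]
    · rw [min_eq_right h]
      omega

end Chains

/-! ### Boundedness -/

theorem countP_map_val {ι : Type*} {n : ℕ} (D : Finset ι) (f : ι → Fin n) (x : ℕ) :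
    (D.val.map f).countP (fun a => a.val < x) = (D.filter fun p => (f p).val < x).card := by
  rw [Multiset.countP_map]
  rfl

/-- The cardinalities always agree, so the failure is one of counts at some `x`. There `T`
contributes the difference of the counts of `α` and `β`, and a negative root contributes exactly
when it straddles `x`. -/
theorem exists_of_not_pairsLE_neg {n : ℕ} {α β : Finset (Fin n)} {T D : Finset (Fin n × Fin n)}
    (hT : Represents β α T) (h : ¬ PairsLE T.val (negPart D).val) :
    ∃ x : ℕ, cnt α x <
      cnt β x + (D.filter fun p => p.1.val < x ∧ x ≤ p.2.val).card := by
  unfold PairsLE at h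
  rw [termLE_iff, not_and] at h
  have hcard := h (by simp [add_comm])
  push Not at hcard
  obtain ⟨x, hx⟩ := hcard
  refine ⟨x, ?_⟩
  rw [Multiset.countP_add, Multiset.countP_add, hT.2.1, hT.2.2, countP_val, countP_val,
    countP_map_val, countP_map_val] at hx
  have h1 := cnt_sdiff_add α β x
  have h2 : ((negPart D).filter fun p => p.1.val < x).card =
      ((negPart D).filter fun p => p.2.val < x).card +
        (D.filter fun p => p.1.val < x ∧ x ≤ p.2.val).card := by
    unfold negPart
    rw [← Finset.card_union_of_disjoint]
    · congr 1
      ext p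
      simp only [Finset.mem_filter, Finset.mem_union, Fin.lt_def]
      by_cases hp : p ∈ D <;> simp only [hp, true_and, false_and, or_false]
      omega
    · rw [Finset.disjoint_left]
      intro p hp hq
      simp only [Finset.mem_filter] at hp hq
      omega
  omega

theorem exists_of_not_pairsLE_pos {n : ℕ} {β γ : Finset (Fin n)} {W D : Finset (Fin n × Fin n)}
    (hW : Represents β γ W) (h : ¬ PairsLE (posPart D).val W.val) :
    ∃ x : ℕ, cnt β x <
      cnt γ x + (D.filter fun p => p.2.val < x ∧ x ≤ p.1.val).card := by
  unfold PairsLE at h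
  rw [termLE_iff, not_and] at h
  have hcard := h (by simp [add_comm])
  push Not at hcard
  obtain ⟨x, hx⟩ := hcard
  refine ⟨x, ?_⟩
  rw [Multiset.countP_add, Multiset.countP_add, hW.2.1, hW.2.2, countP_val, countP_val,
    countP_map_val, countP_map_val] at hx
  have h1 := cnt_sdiff_add γ β x
  have h2 : ((posPart D).filter fun p => p.2.val < x).card =
      ((posPart D).filter fun p => p.1.val < x).card +
        (D.filter fun p => p.2.val < x ∧ x ≤ p.1.val).card := by
    unfold posPart
    rw [← Finset.card_union_of_disjoint]
    · congr 1
      ext p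
      simp only [Finset.mem_filter, Finset.mem_union, Fin.lt_def, gt_iff_lt]
      by_cases hp : p ∈ D <;> simp only [hp, true_and, false_and, or_false]
      omega
    · rw [Finset.disjoint_left]
      intro p hp hq
      simp only [Finset.mem_filter] at hp hq
      omega
  omega

theorem isExtChain_filter {n : ℕ} {D : Finset (Fin n × Fin n)} (hD : IsExtChain D)
    (P : Fin n × Fin n → Prop) [DecidablePred P] : IsExtChain (D.filter P) :=
  IsChain.mono (Finset.coe_subset.2 (Finset.filter_subset P D)) hD

theorem isBoundedBy_doubling {k : Type*} [Field k] {d : ℕ} {α β γ : Idx d}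
    (hα : α.IsIsotropic) (hβ : β.IsIsotropic) (hγ : γ.IsIsotropic)
    {T W : Finset (Fin (2 * d) × Fin (2 * d))} (hT : Represents β.carrier α.carrier T)
    (hW : Represents β.carrier γ.carrier W) {U : UpperRoot β.carrier →₀ ℕ}
    (hU : U ∈ outsideMonomials k α β γ) : IsBoundedBy T W (doubling U) := by
  intro D hDU hD
  constructor
  · by_contra h
    obtain ⟨x, hx⟩ := exists_of_not_pairsLE_neg hT h
    exact hU (monomial_mem_of_negChain hα hβ (isExtChain_filter hD _)
      (fun p hp => hDU p (Finset.mem_filter.1 hp).1) (fun p hp => (Finset.mem_filter.1 hp).2) hx)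
  · by_contra h
    obtain ⟨x, hx⟩ := exists_of_not_pairsLE_pos hW h
    exact hU (monomial_mem_of_posChain hβ hγ (isExtChain_filter hD _)
      (fun p hp => hDU p (Finset.mem_filter.1 hp).1) (fun p hp => (Finset.mem_filter.1 hp).2) hx)

/-! ### The doubling map -/

theorem hash_injective {n : ℕ} : Function.Injective (hash (n := n)) :=
  Function.LeftInverse.injective hash_hash

theorem isSpecial_doubling {n : ℕ} {β : Finset (Fin n)} (U : UpperRoot β →₀ ℕ) :
    IsSpecial (doubling U) := by
  constructor
  · unfold doubling
    rw [Multiset.map_add, Multiset.map_map, Multiset.map_map]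
    have : (hash (n := n) ∘ hash) = id := funext hash_hash
    rw [add_comm, ← Function.comp_assoc, this, Function.id_comp]
  · intro p hp
    have hpp : p = hash p := by
      obtain ⟨r, c⟩ := p
      simp only at hp
      subst hp
      simp [hash]
    unfold doubling
    rw [Multiset.count_add]
    conv =>
      congr
      rhs
      rw [hpp]
    rw [Multiset.count_map_eq_count' _ _ hash_injective]
    exact ⟨_, rfl⟩

/-- The image under `#` of an upper root is upper only on the diagonal, where `#` is the identity.
So `U` can be read off from the multiplicities at upper roots. -/
theorem count_doubling {n : ℕ} {β : Finset (Fin n)} (U : UpperRoot β →₀ ℕ) (q : UpperRoot β) :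
    (doubling U).count q.pair = U q + if q.pair.1 = q.pair.2.rev then U q else 0 := by
  classical
  unfold doubling
  rw [Multiset.count_add, Multiset.count_map_eq_count' _ _ UpperRoot.pair_injective,
    Finsupp.count_toMultiset]
  congr 1
  split_ifs with h
  · have hq : q.pair = hash q.pair := Prod.ext h (by simp [hash, h])
    conv_lhs => rw [hq]
    rw [Multiset.count_map_eq_count' _ _ hash_injective,
      Multiset.count_map_eq_count' _ _ UpperRoot.pair_injective, Finsupp.count_toMultiset]
  · rw [Multiset.count_eq_zero]
    intro hmem
    obtain ⟨_, hp, hp'⟩ := Multiset.mem_map.1 hmem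
    obtain ⟨p, _, rfl⟩ := Multiset.mem_map.1 hp
    have h1 := p.isUpperRoot.2
    have h2 := q.isUpperRoot.2
    rw [← hp'] at h h2
    simp only [hash, Fin.rev_rev] at h h2
    exact h (le_antisymm h2 h1)

theorem doubling_injective {n : ℕ} {β : Finset (Fin n)} :
    Function.Injective (doubling (β := β)) := by
  intro U V h
  ext q
  have hU := count_doubling U q
  have hV := count_doubling V q
  rw [h] at hU
  split_ifs at hU hV <;> omega

theorem card_doubling {n : ℕ} {β : Finset (Fin n)} (U : UpperRoot β →₀ ℕ) :
    (doubling U).card = 2 * U.degree := by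
  unfold doubling
  rw [Multiset.card_add, Multiset.card_map, Multiset.card_map, Multiset.card_map,
    Finsupp.card_toMultiset, two_mul]
  rfl

end SympGrass

end

theorem theorem4p1 {k : Type*} [Field k] [IsAlgClosed k] {d : ℕ} (hd : 0 < d)
    (α β γ : SympGrass.Idx d)
    (hα : α.IsIsotropic) (hβ : β.IsIsotropic) (hγ : γ.IsIsotropic)
    (hαβ : α ≤ β) (hβγ : β ≤ γ)
    (T W : Finset (Fin (2 * d) × Fin (2 * d)))
    (hT : SympGrass.Represents β.carrier α.carrier T)
    (hW : SympGrass.Represents β.carrier γ.carrier W) :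
    Set.MapsTo SympGrass.doubling (SympGrass.outsideMonomials k α β γ)
        (SympGrass.boundedSpecialMultisets β.carrier T W) ∧
      Set.InjOn SympGrass.doubling (SympGrass.outsideMonomials k α β γ) ∧
      ∀ U ∈ SympGrass.outsideMonomials k α β γ,
        Multiset.card (SympGrass.doubling U) = 2 * U.degree := by
  refine ⟨fun U hU => ⟨fun p hp => SympGrass.isRoot_of_mem_doubling hβ hp, fun p hp h => ?_,
    SympGrass.isSpecial_doubling U, SympGrass.isBoundedBy_doubling hα hβ hγ hT hW hU⟩,
    SympGrass.doubling_injective.injOn, fun U _ => SympGrass.card_doubling U⟩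
  have := SympGrass.isRoot_of_mem_doubling hβ hp
  exact this.1 (h ▸ this.2)
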